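/- Let $(M^3,g)$ be a smooth Riemannian 3-manifold and let $\gamma_0: I\to M^3$ be a unit-speed geodesic, where $I\ni 0$ is an open interval. Let $E_1,E_2,E_3$ be parallel vector fields along $\gamma_0$ that are orthonormal at $\gamma_0(0)$ and satisfy $E_1(0)=\dot\gamma_0(0)$. Let $(x_1,x_2,x_3)$ be local Fermi normal coordinates about $\gamma_0$. That is, they form a smooth chart in which the point with coordinates $(s,ta,tb)$ is the point at time $t$ of the geodesic that starts at $\gamma_0(s)$ with velocity $aE_2(s)+bE_3(s)$; the image of the chart is an open set that meets the $x_1$-axis exactly in $\{(s,0,0): s\in I\}$ and contains with each point $(s,a,b)$ the segment from $(s,0,0)$ to $(s,a,b)$. Let $g_{jk}$ be the components of the metric in these coordinates, and write $g_{jk,i_1\cdots i_m}=\partial_{x_{i_1}}\cdots\partial_{x_{i_m}}g_{jk}$. For $x_1\in I$ and $-\pi\le\theta<\pi$ let $\gamma=\gamma_{x_1,\theta}$ be the geodesic parameterized by arclength which, in these coordinates, satisfies $$\gamma(0)=(x_1,0,0),\qquad \dot\gamma(0)=(\cos\theta,\sin\theta,0).$$ Then $$\frac{d^2\gamma}{dt^2}(0)=0,$$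 and, if $\gamma^3$ denotes the third coordinate of $\gamma$, $$\frac{d^3\gamma^3}{dt^3}(0)=\tfrac12\cos^2\theta\,\sin\theta\; g_{11,23}(x_1,0,0)+3\cos\theta\,\sin^2\theta\; g_{12,23}(x_1,0,0),$$ $$\frac{d^4\gamma^3}{dt^4}(0)=\cos^3\theta\,\sin\theta\; g_{11,123}(x_1,0,0)+O(\theta^2).$$ Here the $O(\theta^2)$ term is bounded by $C\theta^2$, where, for every compact set $K\subset I$, the constant $C$ can be chosen independently of $x_1\in K$ and $\theta\in[-\pi,\pi)$. -/

import Mathlib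

open scoped Manifold ContDiff

noncomputable section

/-- Coordinate space `ℝ³` with its Euclidean norm. -/
abbrev E3 : Type := EuclideanSpace ℝ (Fin 3)

/-- Smooth Riemannian metrics on the tangent bundle of a 3-manifold `M`. -/
abbrev SmoothMetric (M : Type*) [TopologicalSpace M] [ChartedSpace E3 M]
    [IsManifold (𝓡 3) ∞ M] :=
  Bundle.ContMDiffRiemannianMetric (𝓡 3) ∞ E3 (fun x : M => TangentSpace (𝓡 3) x)

/-- The partial derivative `∂f/∂xᵢ` at `x`. -/
def partialD (i : Fin 3) (f : E3 → ℝ) (x : E3) : ℝ :=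
  fderiv ℝ f x (EuclideanSpace.single i 1)

section Coordinates

variable {M : Type*} [TopologicalSpace M] [ChartedSpace E3 M]

/-- The coordinate vector field `∂/∂xᵢ` of the chart `ψ`, at the point with coordinates `x`. -/
def coordVec (ψ : OpenPartialHomeomorph M E3) (i : Fin 3) (x : E3) :
    TangentSpace (𝓡 3) (ψ.symm x) :=
  mfderiv (𝓡 3) (𝓡 3) ψ.symm x (EuclideanSpace.single i (1 : ℝ) : E3)

/-- The components `(v¹, v², v³)` of a tangent vector `v` at `p` in the chart `ψ`. -/
def components (ψ : OpenPartialHomeomorph M E3) (p : M) (v : TangentSpace (𝓡 3) p) : E3 :=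
  mfderiv (𝓡 3) (𝓡 3) ψ p v

/-- The velocity of a curve at time `t`, as a point of the tangent bundle. -/
def velocity (c : ℝ → M) (t : ℝ) : TangentBundle (𝓡 3) M :=
  ⟨c t, mfderiv 𝓘(ℝ, ℝ) (𝓡 3) c t (1 : ℝ)⟩

variable [IsManifold (𝓡 3) ∞ M]

/-- The components `g_{ij}` of the metric in the chart `ψ`, as functions of the coordinates. -/
def metricComp (g : SmoothMetric M) (ψ : OpenPartialHomeomorph M E3) (i j : Fin 3) (x : E3) : ℝ :=
  g.inner (ψ.symm x) (coordVec ψ i x) (coordVec ψ j x)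

/-- The Christoffel symbols of the first kind,
`Γ_{ijl} = (g_{il,j} + g_{jl,i} - g_{ij,l}) / 2`. -/
def christoffelFirst (g : SmoothMetric M) (ψ : OpenPartialHomeomorph M E3)
    (i j l : Fin 3) (x : E3) : ℝ :=
  (partialD j (metricComp g ψ i l) x + partialD i (metricComp g ψ j l) x
    - partialD l (metricComp g ψ i j) x) / 2

/-- The Christoffel symbols `Γ_{ij}^k = ∑ₗ Γ_{ijl} g^{lk}`, with `(g^{lk})` the inverse matrix
of `(g_{lk})`. -/
def christoffel (g : SmoothMetric M) (ψ : OpenPartialHomeomorph M E3)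
    (i j k : Fin 3) (x : E3) : ℝ :=
  ∑ l, christoffelFirst g ψ i j l x *
    (Matrix.of fun a b => metricComp g ψ a b x)⁻¹ l k

/-- The curve `c` is a geodesic on the set `J` of parameters: it is smooth near each point of `J`,
and there it satisfies, in every chart `ψ` of the manifold, the geodesic equation
`(c^k)'' + ∑ Γ_{ij}^k (c^i)' (c^j)' = 0`. -/
def IsGeodesicOn (g : SmoothMetric M) (c : ℝ → M) (J : Set ℝ) : Prop :=
  ∀ t ∈ J, ContMDiffAt 𝓘(ℝ, ℝ) (𝓡 3) ∞ c t ∧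
    ∀ ψ ∈ IsManifold.maximalAtlas (𝓡 3) ∞ M, c t ∈ ψ.source → ∀ k : Fin 3,
      iteratedDeriv 2 (fun s => ψ (c s) k) t
        + ∑ i, ∑ j, christoffel g ψ i j k (ψ (c t))
            * deriv (fun s => ψ (c s) i) t * deriv (fun s => ψ (c s) j) t = 0

/-- The vector field `V` along the curve `c` is parallel on `J`: in every chart `ψ`,
`dV^k/dt + ∑ Γ_{ij}^k (c^i)' V^j = 0`. -/
def IsParallelOn (g : SmoothMetric M) (c : ℝ → M) (V : ∀ t, TangentSpace (𝓡 3) (c t))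
    (J : Set ℝ) : Prop :=
  ∀ t ∈ J, ∀ ψ ∈ IsManifold.maximalAtlas (𝓡 3) ∞ M, c t ∈ ψ.source → ∀ k : Fin 3,
    HasDerivAt (fun s => components ψ (c s) (V s) k)
      (-∑ i, ∑ j, christoffel g ψ i j k (ψ (c t))
          * deriv (fun s => ψ (c s) i) t * components ψ (c t) (V t) j) t

/-- `φ` is a local Fermi normal coordinate system about the geodesic `γ₀ : I → M`, built from the
frame `E` along `γ₀`; the indices `0, 1, 2` stand for the coordinates `x₁, x₂, x₃`. -/
structure IsFermiChart (g : SmoothMetric M) (γ₀ : ℝ → M) (I : Set ℝ)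
    (E : Fin 3 → ∀ s, TangentSpace (𝓡 3) (γ₀ s)) (φ : OpenPartialHomeomorph M E3) : Prop where
  isOpen : IsOpen I
  ordConnected : I.OrdConnected
  zero_mem : (0 : ℝ) ∈ I
  geodesic : IsGeodesicOn g γ₀ I
  /-- The frame is orthonormal at the base point `γ₀ 0`, -/
  orthonormal : ∀ i j, g.inner (γ₀ 0) (E i 0) (E j 0) = if i = j then 1 else 0
  /-- its first vector there is the tangent vector of `γ₀`, -/
  velocity_zero : velocity γ₀ 0 = ⟨γ₀ 0, E 0 0⟩
  /-- and it is propagated along `γ₀` by parallel transport. -/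
  parallel : ∀ i, IsParallelOn g γ₀ (E i) I
  /-- `φ` is a smooth chart of `M`. -/
  mem_atlas : φ ∈ IsManifold.maximalAtlas (𝓡 3) ∞ M
  /-- The coordinate domain meets the `x₁`-axis exactly in `I`, -/
  axis : ∀ s : ℝ, (!₂[s, 0, 0] : E3) ∈ φ.target ↔ s ∈ I
  /-- and contains with each point the segment that joins it to the axis. -/
  star : ∀ s a b t : ℝ, (!₂[s, a, b] : E3) ∈ φ.target → t ∈ Set.Icc (0 : ℝ) 1 →
    (!₂[s, t * a, t * b] : E3) ∈ φ.target
  /-- The point with coordinates `(s, t a, t b)` is the point at time `t` of the geodesic that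
  leaves `γ₀ s` with velocity `a E₂(s) + b E₃(s)`. -/
  radial_geodesic : ∀ s ∈ I, ∀ a b : ℝ,
    IsGeodesicOn g (fun t => φ.symm !₂[s, t * a, t * b]) {t | (!₂[s, t * a, t * b] : E3) ∈ φ.target}
  radial_velocity : ∀ s ∈ I, ∀ a b : ℝ,
    velocity (fun t => φ.symm !₂[s, t * a, t * b]) 0 = ⟨γ₀ s, a • E 1 s + b • E 2 s⟩

/-- `γ` is, for small times, the geodesic that has, in the coordinates `φ`, the initial position
`(x₁, 0, 0)` and the initial velocity `(cos θ, sin θ, 0)`. -/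
def IsGeodesicFrom (g : SmoothMetric M) (φ : OpenPartialHomeomorph M E3) (x₁ θ : ℝ)
    (γ : ℝ → M) : Prop :=
  (∃ ε > 0, IsGeodesicOn g γ (Set.Ioo (-ε) ε)) ∧
    γ 0 = φ.symm !₂[x₁, 0, 0] ∧
    velocity γ 0 = ⟨φ.symm !₂[x₁, 0, 0],
      Real.cos θ • coordVec φ 0 !₂[x₁, 0, 0] + Real.sin θ • coordVec φ 1 !₂[x₁, 0, 0]⟩

end Coordinates

end

open Filter Topology

noncomputable section

/-! In Fermi coordinates every Christoffel symbol vanishes on the axis: the axis is a geodesic, the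
transported frame has constant components along it, and the radial lines are geodesics
(`IsFermiChart.lowerGamma_axis`). Hence the first derivatives of the metric vanish there and the
metric is the identity.

With its index lowered, the geodesic equation reads `g_{kl} c''^k + Γ_{ijl} c'^i c'^j = 0`. It and
its first two derivatives at time 0 give `c'' = 0`, and they express the third and fourth
derivatives as minus the first and second derivatives of `Γ_{ijl}` contracted with the initial
velocity; all other terms carry a factor that vanishes on the axis (`taylor_geodesic`).

With velocity `(p, q, 0)`, derivatives along the axis drop out. Differentiating the radial geodesic
equation yields `g_{02,11} = -2 g_{01,12}` and `∂₁Γ_{112} = 0` on the axis (indices from 0), which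
settles order three. At order four the `p⁴` term vanishes, the `p³q` term is the stated one, and
what remains contains `q²`; compactness bounds its coefficients, and `|sin θ| ≤ |θ|` ends the proof.
-/

theorem two_le_infty : (2 : WithTop ℕ∞) ≤ ∞ := by norm_cast

/-! ### Partial derivatives on coordinate space. -/

theorem ContDiffOn.partialD {f : E3 → ℝ} {U : Set E3} (hU : IsOpen U) (hf : ContDiffOn ℝ ∞ f U)
    (i : Fin 3) : ContDiffOn ℝ ∞ (partialD i f) U := by
  have h : ContDiffOn ℝ ∞ (fderiv ℝ f) U := hf.fderiv_of_isOpen hU le_rfl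
  exact h.clm_apply contDiffOn_const

theorem partialD_comm {f : E3 → ℝ} {U : Set E3} (hU : IsOpen U) (hf : ContDiffOn ℝ ∞ f U)
    (i j : Fin 3) {x : E3} (hx : x ∈ U) :
    partialD i (partialD j f) x = partialD j (partialD i f) x := by
  have hfx : ContDiffAt ℝ ∞ f x := hf.contDiffAt (hU.mem_nhds hx)
  have hd : DifferentiableAt ℝ (fderiv ℝ f) x :=
    (hfx.fderiv_right (m := 1) (by norm_num; exact two_le_infty)).differentiableAt (by simp)
  have key : ∀ i j : Fin 3, partialD i (partialD j f) x
      = fderiv ℝ (fderiv ℝ f) x (EuclideanSpace.single i 1) (EuclideanSpace.single j 1) := by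
    intro i j
    have := (hd.hasFDerivAt.clm_apply (hasFDerivAt_const (EuclideanSpace.single j (1:ℝ)) x)).fderiv
    change fderiv ℝ (fun y => fderiv ℝ f y (EuclideanSpace.single j 1)) x _ = _
    rw [this]
    simp
  rw [key, key]
  exact (hfx.isSymmSndFDerivAt (by simpa using two_le_infty)).eq _ _

/-- The chain rule along a curve, in terms of partial derivatives. -/
theorem hasDerivAt_comp_curve {f : E3 → ℝ} {c : ℝ → E3} {v : Fin 3 → ℝ} {t : ℝ}
    (hf : DifferentiableAt ℝ f (c t)) (hc : ∀ m, HasDerivAt (fun s => c s m) (v m) t) :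
    HasDerivAt (fun s => f (c s)) (∑ m, partialD m f (c t) * v m) t := by
  have hc' : HasDerivAt c (WithLp.toLp 2 v) t := by
    rw [hasDerivAt_iff_hasFDerivAt, ← hasFDerivWithinAt_univ, hasFDerivWithinAt_euclidean]
    intro m
    rw [hasFDerivWithinAt_univ]
    exact (hc m).hasFDerivAt
  have := hf.hasFDerivAt.comp_hasDerivAt t hc'
  have hv : (WithLp.toLp 2 v : E3) = ∑ m, v m • EuclideanSpace.single m (1:ℝ) := by
    ext k; simp [Fin.sum_univ_three]; fin_cases k <;> simp
  rw [hv, map_sum] at this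
  simpa [partialD, mul_comm, Function.comp_def] using this

/-- Along the axis the chain rule sees only `∂₀`. An identity known merely on the axis may therefore
still be differentiated in that direction. -/
theorem partialD_zero_axis {f : E3 → ℝ} {I : Set ℝ} (hI : IsOpen I)
    (h0 : ∀ s ∈ I, f !₂[s, 0, 0] = 0) {s : ℝ} (hs : s ∈ I)
    (hf : DifferentiableAt ℝ f !₂[s, 0, 0]) : partialD 0 f !₂[s, 0, 0] = 0 := by
  have h := hasDerivAt_comp_curve (c := fun s => !₂[s, 0, 0]) (v := ![1, 0, 0]) (t := s) hf
    (by
      intro m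
      fin_cases m
      · simpa using hasDerivAt_id' s
      · simpa using hasDerivAt_const s (0:ℝ)
      · simpa using hasDerivAt_const s (0:ℝ))
  have h' : (fun s => f !₂[s, 0, 0]) =ᶠ[𝓝 s] fun _ => 0 := by
    filter_upwards [hI.mem_nhds hs] with r hr using h0 r hr
  have := h.unique ((hasDerivAt_const s (0:ℝ)).congr_of_eventuallyEq h')
  simpa [Fin.sum_univ_three] using this

/-! ### Metrics in Fermi coordinates, separated from the manifold. -/

/-- The Christoffel symbols of the first kind of a matrix of functions on coordinate space. -/
def lowerGamma (G : Fin 3 → Fin 3 → E3 → ℝ) (i j l : Fin 3) (x : E3) : ℝ :=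
  (partialD j (G i l) x + partialD i (G j l) x - partialD l (G i j) x) / 2

/-- Metric compatibility of the Levi-Civita connection: it turns vanishing symbols into vanishing
first derivatives of the metric. -/
theorem partialD_eq_lowerGamma {G : Fin 3 → Fin 3 → E3 → ℝ} (hG : ∀ i j, G i j = G j i)
    (i j k : Fin 3) (x : E3) :
    partialD k (G i j) x = lowerGamma G i k j x + lowerGamma G j k i x := by
  simp only [lowerGamma, hG j i, hG k j, hG k i]
  ring

/-- The properties of the metric components in Fermi normal coordinates about the interval `I` of
the first axis that are used below. -/
structure IsFermiMetric (G : Fin 3 → Fin 3 → E3 → ℝ) (U : Set E3) (I : Set ℝ) : Prop where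
  isOpen_domain : IsOpen U
  isOpen_axis : IsOpen I
  ordConnected : I.OrdConnected
  zero_mem : (0 : ℝ) ∈ I
  axis_mem : ∀ s ∈ I, (!₂[s, 0, 0] : E3) ∈ U
  contDiffOn : ∀ i j, ContDiffOn ℝ ∞ (G i j) U
  symm : ∀ i j, G i j = G j i
  base : ∀ i j, G i j !₂[0, 0, 0] = if i = j then 1 else 0
  lowerGamma_axis : ∀ s ∈ I, ∀ i j l, lowerGamma G i j l !₂[s, 0, 0] = 0
  radial : ∀ s ∈ I, ∀ a b : ℝ, ∀ l, ∀ᶠ t in 𝓝 (0 : ℝ),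
    ∑ i, ∑ j, lowerGamma G i j l !₂[s, t * a, t * b] * ![0, a, b] i * ![0, a, b] j = 0

namespace IsFermiMetric

variable {G : Fin 3 → Fin 3 → E3 → ℝ} {U : Set E3} {I : Set ℝ}

theorem contDiffOn_lowerGamma (h : IsFermiMetric G U I) (i j l : Fin 3) :
    ContDiffOn ℝ ∞ (lowerGamma G i j l) U :=
  ((((h.contDiffOn i l).partialD h.isOpen_domain j).add
    ((h.contDiffOn j l).partialD h.isOpen_domain i)).sub
    ((h.contDiffOn i j).partialD h.isOpen_domain l)).div_const 2

theorem differentiableAt (h : IsFermiMetric G U I) {f : E3 → ℝ} (hf : ContDiffOn ℝ ∞ f U) {x : E3}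
    (hx : x ∈ U) : DifferentiableAt ℝ f x :=
  (hf.contDiffAt (h.isOpen_domain.mem_nhds hx)).differentiableAt (by simp)

theorem partialD_axis (h : IsFermiMetric G U I) {s : ℝ} (hs : s ∈ I) (i j k : Fin 3) :
    partialD k (G i j) !₂[s, 0, 0] = 0 := by
  rw [partialD_eq_lowerGamma h.symm, h.lowerGamma_axis s hs, h.lowerGamma_axis s hs, add_zero]

/-- Orthonormality is known only at the origin. It spreads because the derivative along the axis is
zero and `I` is an interval. -/
theorem axis_eq (h : IsFermiMetric G U I) {s : ℝ} (hs : s ∈ I) (i j : Fin 3) :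
    G i j !₂[s, 0, 0] = if i = j then 1 else 0 := by
  rw [← h.base i j]
  have hd : ∀ r ∈ I, HasDerivAt (fun r => G i j !₂[r, 0, 0]) 0 r := fun r hr => by
    have := hasDerivAt_comp_curve (c := fun r => !₂[r, 0, 0]) (v := ![1, 0, 0]) (t := r)
      (h.differentiableAt (h.contDiffOn i j) (h.axis_mem r hr))
      (by
        intro m
        fin_cases m
        · simpa using hasDerivAt_id' r
        · simpa using hasDerivAt_const r (0:ℝ)
        · simpa using hasDerivAt_const r (0:ℝ))
    simpa [h.partialD_axis hr] using this
  exact h.ordConnected.convex.is_const_of_fderivWithin_eq_zero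
    (fun r hr => (hd r hr).differentiableAt.differentiableWithinAt)
    (fun r hr => by
      rw [fderivWithin_of_isOpen h.isOpen_axis hr]
      ext
      simp [(hd r hr).deriv]) hs h.zero_mem

theorem partialD_zero_partialD (h : IsFermiMetric G U I) {s : ℝ} (hs : s ∈ I) (i j k : Fin 3) :
    partialD 0 (partialD k (G i j)) !₂[s, 0, 0] = 0 :=
  partialD_zero_axis h.isOpen_axis (fun _ hr => h.partialD_axis hr i j k) hs
    (h.differentiableAt ((h.contDiffOn i j).partialD h.isOpen_domain k) (h.axis_mem s hs))

theorem partialD_partialD_zero (h : IsFermiMetric G U I) {s : ℝ} (hs : s ∈ I) (i j k : Fin 3) :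
    partialD k (partialD 0 (G i j)) !₂[s, 0, 0] = 0 := by
  rw [partialD_comm h.isOpen_domain (h.contDiffOn i j) k 0 (h.axis_mem s hs),
    h.partialD_zero_partialD hs]

theorem partialD_lowerGamma (h : IsFermiMetric G U I) {x : E3} (hx : x ∈ U) (m i j l : Fin 3) :
    partialD m (lowerGamma G i j l) x = (partialD m (partialD j (G i l)) x
      + partialD m (partialD i (G j l)) x - partialD m (partialD l (G i j)) x) / 2 := by
  have hd : ∀ i j k, HasFDerivAt (partialD k (G i j)) (fderiv ℝ (partialD k (G i j)) x) x :=
    fun i j k => (h.differentiableAt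
      ((h.contDiffOn i j).partialD h.isOpen_domain k) hx).hasFDerivAt
  have := (((hd i l j).add (hd j l i)).sub (hd i j l)).mul_const (2⁻¹ : ℝ)
  have h2 : fderiv ℝ (lowerGamma G i j l) x = _ := HasFDerivAt.fderiv this
  rw [partialD, h2]
  simp only [partialD, FunLike.coe_smul, FunLike.coe_sub, FunLike.coe_add, Pi.smul_apply,
    Pi.sub_apply, Pi.add_apply, smul_eq_mul]
  ring

/-- The derivative at `t = 0` of the geodesic equation along a ray: a cubic form in `(a, b)` that
vanishes identically. -/
theorem radial_partialD (h : IsFermiMetric G U I) {s : ℝ} (hs : s ∈ I) (a b : ℝ) (l : Fin 3) :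
    ∑ i, ∑ j, (∑ m, partialD m (lowerGamma G i j l) !₂[s, 0, 0] * ![0, a, b] m)
      * ![0, a, b] i * ![0, a, b] j = 0 := by
  have hd : ∀ i j, HasDerivAt (fun t : ℝ => lowerGamma G i j l !₂[s, t * a, t * b])
      (∑ m, partialD m (lowerGamma G i j l) !₂[s, 0, 0] * ![0, a, b] m) 0 := fun i j => by
    have := hasDerivAt_comp_curve (f := lowerGamma G i j l) (v := ![0, a, b]) (t := 0)
      (c := fun t => !₂[s, t * a, t * b])
      (by simpa using h.differentiableAt (h.contDiffOn_lowerGamma i j l) (h.axis_mem s hs))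
      (by
        intro m
        fin_cases m
        · simpa using hasDerivAt_const (0:ℝ) s
        · simpa using (hasDerivAt_id' (0:ℝ)).mul_const a
        · simpa using (hasDerivAt_id' (0:ℝ)).mul_const b)
    simpa using this
  have h1 := HasDerivAt.fun_sum (u := Finset.univ) fun i _ =>
    HasDerivAt.fun_sum (u := Finset.univ) fun j _ =>
      ((hd i j).mul_const (![0, a, b] i)).mul_const (![0, a, b] j)
  exact h1.unique ((hasDerivAt_const (0:ℝ) (0:ℝ)).congr_of_eventuallyEq (h.radial s hs a b l))

theorem partialD_one_lowerGamma_one_one (h : IsFermiMetric G U I) {s : ℝ} (hs : s ∈ I) (l : Fin 3) :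
    partialD 1 (lowerGamma G 1 1 l) !₂[s, 0, 0] = 0 := by
  simpa [Fin.sum_univ_three] using h.radial_partialD hs 1 0 l

/-- For `l = 0` the `a²b` coefficient of the radial cubic form is `2 g_{01,12} + g_{02,11}`, up to
terms containing `∂₀`, which vanish. The directions `(1, 1)`, `(1, -1)` and `(0, 1)` isolate it. -/
theorem partialD_one_partialD_one (h : IsFermiMetric G U I) {s : ℝ} (hs : s ∈ I) :
    partialD 1 (partialD 1 (G 0 2)) !₂[s, 0, 0]
      = -2 * partialD 1 (partialD 2 (G 0 1)) !₂[s, 0, 0] := by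
  have h1 := h.radial_partialD hs 1 1 0
  have h2 := h.radial_partialD hs 1 (-1) 0
  have h3 := h.radial_partialD hs 0 1 0
  simp [Fin.sum_univ_three, h.partialD_lowerGamma (h.axis_mem s hs),
    h.partialD_partialD_zero hs] at h1 h2 h3
  rw [partialD_comm h.isOpen_domain (h.contDiffOn 1 0) 2 1 (h.axis_mem s hs), h.symm 1 0,
    h.symm 2 0] at h1 h2
  simp only [h.symm 2 0] at h3
  linarith

end IsFermiMetric

/-! ### Taylor coefficients of geodesics that start on the axis. -/

theorem ContDiffAt.hasDerivAt_iteratedDeriv {f : ℝ → ℝ} {n k : ℕ} {t : ℝ}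
    (hf : ContDiffAt ℝ n f t) (hk : k < n) :
    HasDerivAt (iteratedDeriv k f) (iteratedDeriv (k + 1) f t) t := by
  rw [iteratedDeriv_succ]
  refine DifferentiableAt.hasDerivAt ?_
  rw [← differentiableWithinAt_univ, ← iteratedDerivWithin_univ]
  exact (contDiffWithinAt_univ.2 hf).differentiableWithinAt_iteratedDerivWithin
    (by exact_mod_cast hk) (by simp)

/-- The geodesic equation with lowered index, for a curve in coordinate space. -/
def LowerGeodesicEq (G : Fin 3 → Fin 3 → E3 → ℝ) (c : ℝ → E3) (t : ℝ) : Prop :=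
  ∀ l, ∑ k, G k l (c t) * iteratedDeriv 2 (fun s => c s k) t
    + ∑ i, ∑ j, lowerGamma G i j l (c t) * iteratedDeriv 1 (fun s => c s i) t
      * iteratedDeriv 1 (fun s => c s j) t = 0

namespace IsFermiMetric

variable {G : Fin 3 → Fin 3 → E3 → ℝ} {U : Set E3} {I : Set ℝ}

/-- The Taylor coefficients up to order four of a geodesic that starts on the axis. -/
theorem taylor_geodesic (h : IsFermiMetric G U I) {s : ℝ} (hs : s ∈ I) {c : ℝ → E3} {v : Fin 3 → ℝ}
    (hc : ContDiffAt ℝ ∞ c 0) (hc0 : c 0 = !₂[s, 0, 0])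
    (hv : ∀ m, iteratedDeriv 1 (fun t => c t m) 0 = v m)
    (hgeo : ∀ᶠ t in 𝓝 0, LowerGeodesicEq G c t) :
    (∀ l, iteratedDeriv 2 (fun t => c t l) 0 = 0) ∧
    (∀ l, iteratedDeriv 3 (fun t => c t l) 0
      = -∑ i, ∑ j, (∑ m, partialD m (lowerGamma G i j l) !₂[s, 0, 0] * v m) * v i * v j) ∧
    (∀ l, iteratedDeriv 4 (fun t => c t l) 0
      = -∑ i, ∑ j, (∑ m, (∑ n, partialD n (partialD m (lowerGamma G i j l)) !₂[s, 0, 0] * v n)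
          * v m) * v i * v j) := by
  have hU := h.isOpen_domain
  have hD2 : ∀ l, iteratedDeriv 2 (fun t => c t l) 0 = 0 := by
    intro l
    have := hgeo.self_of_nhds l
    simpa [hc0, h.lowerGamma_axis s hs, h.axis_eq hs] using this
  have hsm : ∀ᶠ t in 𝓝 (0:ℝ), ∀ m, ContDiffAt ℝ (5:ℕ) (fun s => c s m) t := by
    have := (hc.of_le (show ((5:ℕ) : WithTop ℕ∞) ≤ ∞ by norm_cast)).eventually (by simp)
    filter_upwards [this] with t ht m
    exact contDiffAt_euclidean.1 ht m
  have hmem : ∀ᶠ t in 𝓝 (0:ℝ), c t ∈ U :=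
    hc.continuousAt.eventually (by rw [hc0]; exact hU.mem_nhds (h.axis_mem s hs))
  have hD : ∀ᶠ t in 𝓝 (0:ℝ), ∀ m, ∀ k < 4, HasDerivAt (iteratedDeriv k (fun s => c s m))
      (iteratedDeriv (k + 1) (fun s => c s m) t) t := by
    filter_upwards [hsm] with t ht m k hk
    exact (ht m).hasDerivAt_iteratedDeriv (by omega)
  have hcomp : ∀ᶠ t in 𝓝 (0:ℝ), ∀ f : E3 → ℝ, ContDiffOn ℝ ∞ f U →
      HasDerivAt (fun t => f (c t))
        (∑ m, partialD m f (c t) * iteratedDeriv 1 (fun s => c s m) t) t := by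
    filter_upwards [hD, hmem] with t ht hm f hf
    exact hasDerivAt_comp_curve (h.differentiableAt hf hm)
      fun m => by simpa using ht m 0 (by norm_num)
  -- The once-differentiated equation is kept on a neighbourhood of 0, since it has to be
  -- differentiated again.
  have hF' : ∀ᶠ t in 𝓝 (0:ℝ), ∀ l,
      ∑ k, ((∑ m, partialD m (G k l) (c t) * iteratedDeriv 1 (fun s => c s m) t)
          * iteratedDeriv 2 (fun s => c s k) t + G k l (c t) * iteratedDeriv 3 (fun s => c s k) t)
        + ∑ i, ∑ j,
          (((∑ m, partialD m (lowerGamma G i j l) (c t) * iteratedDeriv 1 (fun s => c s m) t)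
              * iteratedDeriv 1 (fun s => c s i) t
            + lowerGamma G i j l (c t) * iteratedDeriv 2 (fun s => c s i) t)
              * iteratedDeriv 1 (fun s => c s j) t
            + lowerGamma G i j l (c t) * iteratedDeriv 1 (fun s => c s i) t
              * iteratedDeriv 2 (fun s => c s j) t) = 0 := by
    filter_upwards [hcomp, hD, hgeo.eventually_nhds] with t h1 h2 h3 l
    have := (HasDerivAt.fun_sum (u := Finset.univ) fun k _ =>
      (h1 _ (h.contDiffOn k l)).fun_mul (h2 k 2 (by norm_num))).fun_add
      (HasDerivAt.fun_sum (u := Finset.univ) fun i _ =>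
        HasDerivAt.fun_sum (u := Finset.univ) fun j _ =>
          ((h1 _ (h.contDiffOn_lowerGamma i j l)).fun_mul (h2 i 1 (by norm_num))).fun_mul
            (h2 j 1 (by norm_num)))
    exact this.unique ((hasDerivAt_const t (0:ℝ)).congr_of_eventuallyEq
      (h3.mono fun r hr => hr l))
  refine ⟨hD2, fun l => ?_, fun l => ?_⟩
  · have := hF'.self_of_nhds l
    simp only [hc0, hv, hD2, h.lowerGamma_axis s hs, h.axis_eq hs, mul_zero, zero_mul, add_zero,
      zero_add, ite_mul, one_mul, Finset.sum_ite_eq', Finset.mem_univ, if_true] at this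
    linarith
  · have h1 := hcomp.self_of_nhds
    have h2 := hD.self_of_nhds
    have := (HasDerivAt.fun_sum (u := Finset.univ) fun k _ =>
      ((HasDerivAt.fun_sum (u := Finset.univ) fun m _ =>
        (h1 _ ((h.contDiffOn k l).partialD hU m)).fun_mul (h2 m 1 (by norm_num))).fun_mul
          (h2 k 2 (by norm_num))).fun_add
      ((h1 _ (h.contDiffOn k l)).fun_mul (h2 k 3 (by norm_num)))).fun_add
      (HasDerivAt.fun_sum (u := Finset.univ) fun i _ =>
        HasDerivAt.fun_sum (u := Finset.univ) fun j _ =>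
          ((((HasDerivAt.fun_sum (u := Finset.univ) fun m _ =>
            (h1 _ ((h.contDiffOn_lowerGamma i j l).partialD hU m)).fun_mul
              (h2 m 1 (by norm_num))).fun_mul (h2 i 1 (by norm_num))).fun_add
            ((h1 _ (h.contDiffOn_lowerGamma i j l)).fun_mul (h2 i 2 (by norm_num)))).fun_mul
              (h2 j 1 (by norm_num))).fun_add
            (((h1 _ (h.contDiffOn_lowerGamma i j l)).fun_mul (h2 i 1 (by norm_num))).fun_mul
              (h2 j 2 (by norm_num))))
    have h0 := this.unique ((hasDerivAt_const (0:ℝ) (0:ℝ)).congr_of_eventuallyEq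
      (hF'.mono fun r hr => hr l))
    -- The third derivatives of `c` occur only multiplied by `∂G` or `Γ`, which vanish on the axis.
    simp only [hc0, hv, hD2, h.lowerGamma_axis s hs, h.axis_eq hs, h.partialD_axis hs,
      Nat.reduceAdd, Finset.sum_const_zero, mul_zero, zero_mul, add_zero,
      zero_add, ite_mul, one_mul, Finset.sum_ite_eq', Finset.mem_univ, if_true] at h0
    linarith

theorem third_deriv_geodesic (h : IsFermiMetric G U I) {s : ℝ} (hs : s ∈ I) {c : ℝ → E3}
    {p q : ℝ} (hc : ContDiffAt ℝ ∞ c 0) (hc0 : c 0 = !₂[s, 0, 0])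
    (hv : ∀ m, iteratedDeriv 1 (fun t => c t m) 0 = ![p, q, 0] m)
    (hgeo : ∀ᶠ t in 𝓝 0, LowerGeodesicEq G c t) :
    iteratedDeriv 3 (fun t => c t 2) 0
      = 1 / 2 * p ^ 2 * q * partialD 1 (partialD 2 (G 0 0)) !₂[s, 0, 0]
        + 3 * p * q ^ 2 * partialD 1 (partialD 2 (G 0 1)) !₂[s, 0, 0] := by
  rw [(h.taylor_geodesic hs hc hc0 hv hgeo).2.1 2]
  simp [Fin.sum_univ_three, h.partialD_one_lowerGamma_one_one hs]
  simp [h.partialD_lowerGamma (h.axis_mem s hs), h.partialD_partialD_zero hs,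
    h.partialD_zero_partialD hs, h.symm 1 0, h.partialD_one_partialD_one hs]
  ring

theorem partialD_zero_partialD_zero_lowerGamma (h : IsFermiMetric G U I) {s : ℝ} (hs : s ∈ I)
    (i j l : Fin 3) : partialD 0 (partialD 0 (lowerGamma G i j l)) !₂[s, 0, 0] = 0 := by
  have hΓ := h.contDiffOn_lowerGamma i j l
  refine partialD_zero_axis h.isOpen_axis (fun r hr => ?_) hs
    (h.differentiableAt (hΓ.partialD h.isOpen_domain 0) (h.axis_mem s hs))
  exact partialD_zero_axis h.isOpen_axis (fun r hr => h.lowerGamma_axis r hr i j l) hr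
    (h.differentiableAt hΓ (h.axis_mem r hr))

/-- On the axis `∂₁Γ_{002} = -½ ∂₁∂₂ g_{00}`, because the other two terms contain `∂₀`.
Differentiating this along the axis is legitimate although it may fail elsewhere. -/
theorem partialD_zero_partialD_one_lowerGamma (h : IsFermiMetric G U I) {s : ℝ} (hs : s ∈ I) :
    partialD 0 (partialD 1 (lowerGamma G 0 0 2)) !₂[s, 0, 0]
      = -(1 / 2) * partialD 0 (partialD 1 (partialD 2 (G 0 0))) !₂[s, 0, 0] := by
  have hU := h.isOpen_domain
  have h1 := ((h.contDiffOn_lowerGamma 0 0 2).partialD hU 1)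
  have h2 := ((h.contDiffOn 0 0).partialD hU 2).partialD hU 1
  have h1' := (h.differentiableAt h1 (h.axis_mem s hs)).hasFDerivAt
  have h2' := (h.differentiableAt h2 (h.axis_mem s hs)).hasFDerivAt
  have hf := h1'.fun_add (h2'.const_mul (1 / 2))
  have := partialD_zero_axis h.isOpen_axis (fun r hr => ?_) hs hf.differentiableAt
  · rw [partialD, hf.fderiv] at this
    simp only [FunLike.coe_smul, FunLike.coe_add, Pi.smul_apply, Pi.add_apply,
      smul_eq_mul] at this
    simp only [partialD] at this ⊢
    linarith
  · simp only [h.partialD_lowerGamma (h.axis_mem r hr), h.partialD_partialD_zero hr]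
    ring

theorem fourth_deriv_geodesic (h : IsFermiMetric G U I) {K : Set ℝ} (hK : K ⊆ I)
    (hKc : IsCompact K) : ∃ C : ℝ, 0 ≤ C ∧ ∀ s ∈ K, ∀ p q : ℝ, |p| ≤ 1 → |q| ≤ 1 →
      ∀ c : ℝ → E3, ContDiffAt ℝ ∞ c 0 → c 0 = !₂[s, 0, 0] →
      (∀ m, iteratedDeriv 1 (fun t => c t m) 0 = ![p, q, 0] m) →
      (∀ᶠ t in 𝓝 0, LowerGeodesicEq G c t) →
      |iteratedDeriv 4 (fun t => c t 2) 0
        - p ^ 3 * q * partialD 0 (partialD 1 (partialD 2 (G 0 0))) !₂[s, 0, 0]| ≤ C * q ^ 2 := by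
  have hU := h.isOpen_domain
  have hB : ∃ B : ℝ, 0 ≤ B ∧ ∀ s ∈ K, ∀ n m i j,
      |partialD n (partialD m (lowerGamma G i j 2)) !₂[s, 0, 0]| ≤ B := by
    have hbd : ∀ n m i j, ∃ B, ∀ s ∈ K,
        ‖partialD n (partialD m (lowerGamma G i j 2)) !₂[s, 0, 0]‖ ≤ B := fun n m i j =>
      hKc.exists_bound_of_continuousOn <|
        (((h.contDiffOn_lowerGamma i j 2).partialD hU m).partialD hU n).continuousOn.comp
          (by fun_prop) fun s hs => h.axis_mem s (hK hs)
    choose B hB using hbd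
    -- The sum of the finitely many individual bounds dominates each of them.
    refine ⟨∑ n, ∑ m, ∑ i, ∑ j, |B n m i j|, by positivity, fun s hs n m i j => ?_⟩
    refine (hB n m i j s hs).trans ((le_abs_self _).trans ?_)
    refine le_trans ?_ (Finset.single_le_sum (fun n _ => by positivity) (Finset.mem_univ n))
    refine le_trans ?_ (Finset.single_le_sum (fun m _ => by positivity) (Finset.mem_univ m))
    refine le_trans ?_ (Finset.single_le_sum (fun i _ => by positivity) (Finset.mem_univ i))
    exact Finset.single_le_sum (f := fun j => |B n m i j|) (fun j _ => by positivity)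
      (Finset.mem_univ j)
  obtain ⟨B, hB0, hB⟩ := hB
  -- Of the 16 monomials in `p, q`, four vanish through `∂₀∂₀Γ = 0` and two form the `p³q` term; ten
  -- remain, each containing `q²`.
  refine ⟨10 * B, by positivity, fun s hsK p q hp hq c hc hc0 hv hgeo => ?_⟩
  have hs := hK hsK
  have hA := hB s hsK
  have hcomm := partialD_comm hU (h.contDiffOn_lowerGamma 0 0 2) 1 0 (h.axis_mem s hs)
  have h01 := h.partialD_zero_partialD_one_lowerGamma hs
  have hmul : ∀ a r : ℝ, |a| ≤ B → |r| ≤ 1 → |a * r| ≤ B := fun a r ha hr => by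
    rw [abs_mul]
    exact (mul_le_mul ha hr (abs_nonneg _) hB0).trans_eq (mul_one B)
  have hpp : |p * p| ≤ 1 := by rw [abs_mul]; exact mul_le_one₀ hp (abs_nonneg _) hp
  have hpq : |p * q| ≤ 1 := by rw [abs_mul]; exact mul_le_one₀ hp (abs_nonneg _) hq
  have hqq : |q * q| ≤ 1 := by rw [abs_mul]; exact mul_le_one₀ hq (abs_nonneg _) hq
  rw [(h.taylor_geodesic hs hc hc0 hv hgeo).2.2 2]
  generalize hAdef : (fun n m i j => partialD n (partialD m (lowerGamma G i j 2)) !₂[s, 0, 0]) = A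
    at *
  have hA' : ∀ n m i j, partialD n (partialD m (lowerGamma G i j 2)) !₂[s, 0, 0] = A n m i j :=
    fun n m i j => by rw [← hAdef]
  have h00 : ∀ i j, A 0 0 i j = 0 := fun i j => by
    rw [← hA', h.partialD_zero_partialD_zero_lowerGamma hs]
  simp only [hA'] at *
  have key : (-∑ i, ∑ j, (∑ m, (∑ n, A n m i j * ![p, q, 0] n) * ![p, q, 0] m)
        * ![p, q, 0] i * ![p, q, 0] j)
      - p ^ 3 * q * partialD 0 (partialD 1 (partialD 2 (G 0 0))) !₂[s, 0, 0]
      = -(A 1 1 0 0 * (p * p) + A 0 1 1 0 * (p * p) + A 0 1 0 1 * (p * p) + A 1 0 1 0 * (p * p)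
        + A 1 0 0 1 * (p * p) + A 1 1 1 0 * (p * q) + A 1 1 0 1 * (p * q) + A 0 1 1 1 * (p * q)
        + A 1 0 1 1 * (p * q) + A 1 1 1 1 * (q * q)) * q ^ 2 := by
    simp [Fin.sum_univ_three, h00, hcomm, h01]
    ring
  rw [key, abs_mul, abs_of_nonneg (sq_nonneg q)]
  refine mul_le_mul_of_nonneg_right ?_ (sq_nonneg q)
  have e1 := abs_le.1 (hmul _ _ (hA 1 1 0 0) hpp)
  have e2 := abs_le.1 (hmul _ _ (hA 0 1 1 0) hpp)
  have e3 := abs_le.1 (hmul _ _ (hA 0 1 0 1) hpp)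
  have e4 := abs_le.1 (hmul _ _ (hA 1 0 1 0) hpp)
  have e5 := abs_le.1 (hmul _ _ (hA 1 0 0 1) hpp)
  have e6 := abs_le.1 (hmul _ _ (hA 1 1 1 0) hpq)
  have e7 := abs_le.1 (hmul _ _ (hA 1 1 0 1) hpq)
  have e8 := abs_le.1 (hmul _ _ (hA 0 1 1 1) hpq)
  have e9 := abs_le.1 (hmul _ _ (hA 1 0 1 1) hpq)
  have e10 := abs_le.1 (hmul _ _ (hA 1 1 1 1) hqq)
  rw [abs_le]
  constructor <;> linarith

end IsFermiMetric

/-! ### From the manifold to coordinates. -/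

section Coordinates

variable {M : Type*} [TopologicalSpace M] [ChartedSpace E3 M] {φ : OpenPartialHomeomorph M E3}

theorem mdifferentiable_of_mem_maximalAtlas
    (hφ : φ ∈ IsManifold.maximalAtlas (𝓡 3) ∞ M) :
    φ.MDifferentiable (𝓡 3) (𝓡 3) :=
  ⟨(contMDiffOn_of_mem_maximalAtlas hφ).mdifferentiableOn (by simp),
    (contMDiffOn_symm_of_mem_maximalAtlas hφ).mdifferentiableOn (by simp)⟩

/-- The components of a tangent vector in the chart `φ`, as a function on the tangent bundle. -/
def bundleComponents (φ : OpenPartialHomeomorph M E3) (X : TangentBundle (𝓡 3) M) : E3 :=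
  components φ X.proj X.2

theorem bundleComponents_mfderiv_symm (hφ : φ ∈ IsManifold.maximalAtlas (𝓡 3) ∞ M) {x : E3}
    (hx : x ∈ φ.target) (w : E3) :
    bundleComponents φ ⟨φ.symm x, mfderiv (𝓡 3) (𝓡 3) φ.symm x w⟩ = w := by
  have h := (mdifferentiable_of_mem_maximalAtlas hφ).comp_symm_deriv hx
  exact DFunLike.congr_fun h w

theorem hasDerivAt_chart_comp (hφ : φ ∈ IsManifold.maximalAtlas (𝓡 3) ∞ M) {c : ℝ → M} {t : ℝ}
    (hc : MDifferentiableAt 𝓘(ℝ, ℝ) (𝓡 3) c t) (ht : c t ∈ φ.source) :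
    HasDerivAt (fun s => φ (c s)) (bundleComponents φ (velocity c t)) t := by
  have h := ((mdifferentiable_of_mem_maximalAtlas hφ).mdifferentiableAt ht).hasMFDerivAt.comp t
    hc.hasMFDerivAt
  have h' : HasFDerivAt (fun s => φ (c s)) ((mfderiv (𝓡 3) (𝓡 3) φ (c t) : E3 →L[ℝ] E3).comp
      (mfderiv 𝓘(ℝ, ℝ) (𝓡 3) c t : ℝ →L[ℝ] E3)) t := h.hasFDerivAt
  have key : ∀ (f : ℝ → E3) (A : ℝ →L[ℝ] E3), HasFDerivAt f A t → HasDerivAt f (A 1) t :=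
    fun f A h => h.hasDerivAt
  exact key _ _ h'

theorem hasDerivAt_chart_comp_apply (hφ : φ ∈ IsManifold.maximalAtlas (𝓡 3) ∞ M) {c : ℝ → M} {t : ℝ}
    (hc : MDifferentiableAt 𝓘(ℝ, ℝ) (𝓡 3) c t) (ht : c t ∈ φ.source) (m : Fin 3) :
    HasDerivAt (fun s => φ (c s) m) (bundleComponents φ (velocity c t) m) t := by
  have h := hasDerivAt_chart_comp hφ hc ht
  exact (hasDerivAt_pi.1 ((PiLp.hasStrictFDerivAt_ofLp 2 _).hasFDerivAt.comp_hasDerivAt t h)) m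

variable [IsManifold (𝓡 3) ∞ M] {g : SmoothMetric M}

theorem contMDiffOn_coordVec (hφ : φ ∈ IsManifold.maximalAtlas (𝓡 3) ∞ M) (i : Fin 3) :
    ContMDiffOn (𝓡 3) (𝓡 3).tangent ∞
      (fun x => (⟨φ.symm x, coordVec φ i x⟩ : TangentBundle (𝓡 3) M)) φ.target := by
  have h1 := (contMDiffOn_symm_of_mem_maximalAtlas hφ).contMDiffOn_tangentMapWithin (m := ∞)
    le_rfl φ.open_target.uniqueMDiffOn
  have h2 : ContMDiff (𝓡 3) (𝓡 3).tangent ∞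
      (fun x : E3 => (⟨x, EuclideanSpace.single i (1:ℝ)⟩ : TangentBundle (𝓡 3) E3)) :=
    contMDiff_vectorSpace_iff_contDiff.2
      (contDiff_const (c := (EuclideanSpace.single i (1:ℝ) : E3)))
  refine (h1.comp h2.contMDiffOn fun x hx => hx).congr fun x hx => ?_
  simp [tangentMapWithin, coordVec, mfderivWithin_of_isOpen φ.open_target hx]

theorem contDiffOn_metricComp (g : SmoothMetric M) (hφ : φ ∈ IsManifold.maximalAtlas (𝓡 3) ∞ M)
    (i j : Fin 3) : ContDiffOn ℝ ∞ (metricComp g φ i j) φ.target := by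
  rw [← contMDiffOn_iff_contDiffOn]
  intro x hx
  have : ContMDiffWithinAt (𝓡 3) ((𝓡 3).prod 𝓘(ℝ)) ∞
      (fun x => Bundle.TotalSpace.mk' ℝ (E := Bundle.Trivial M ℝ) (φ.symm x)
        (g.inner (φ.symm x) (coordVec φ i x) (coordVec φ j x))) φ.target x := by
    apply ContMDiffWithinAt.clm_bundle_apply₂ (F₁ := E3) (F₂ := E3)
    · exact g.contMDiff.contMDiffAt.comp_contMDiffWithinAt x
        (contMDiffOn_symm_of_mem_maximalAtlas hφ x hx)
    · exact contMDiffOn_coordVec hφ i x hx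
    · exact contMDiffOn_coordVec hφ j x hx
  rw [Bundle.contMDiffWithinAt_totalSpace] at this
  exact this.2

theorem metricComp_symm (g : SmoothMetric M) (φ : OpenPartialHomeomorph M E3) (i j : Fin 3) :
    metricComp g φ i j = metricComp g φ j i :=
  funext fun _ => g.symm _ _ _

/-- A kernel vector would give a tangent vector of zero length, hence zero by positivity, while the
differential of the inverse chart is injective. -/
theorem isUnit_det_metricComp (g : SmoothMetric M) (hφ : φ ∈ IsManifold.maximalAtlas (𝓡 3) ∞ M)
    {x : E3} (hx : x ∈ φ.target) :
    IsUnit (Matrix.of fun a b => metricComp g φ a b x).det := by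
  rw [isUnit_iff_ne_zero]
  intro h0
  obtain ⟨w, hw, hw0⟩ := Matrix.exists_mulVec_eq_zero_iff.2 h0
  have hsum : ∑ i, ∑ j, w i * (metricComp g φ i j x * w j) = 0 := by
    have := congrArg (fun u => ∑ i, w i * u i) hw0
    simpa [Matrix.mulVec, dotProduct, Finset.mul_sum] using this
  set W : TangentSpace (𝓡 3) (φ.symm x) := ∑ i, w i • coordVec φ i x with hW
  have hWW : g.inner (φ.symm x) W W = 0 := by
    rw [← hsum, hW]
    simp [metricComp, Fin.sum_univ_three]
    ring
  have hW0 : W = 0 := by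
    by_contra hne
    exact (g.pos _ W hne).ne' hWW
  have hinj := (mdifferentiable_of_mem_maximalAtlas hφ).symm.mfderiv_injective (x := x) hx
  have : mfderiv (𝓡 3) (𝓡 3) φ.symm x (WithLp.toLp 2 w : E3) = 0 := by
    have hv : (WithLp.toLp 2 w : E3) = ∑ m, w m • EuclideanSpace.single m (1:ℝ) := by
      ext k; simp [Fin.sum_univ_three]; fin_cases k <;> simp
    rw [← hW0, hW, hv]
    refine (map_sum (mfderiv (𝓡 3) (𝓡 3) φ.symm x) _ _).trans ?_
    exact Finset.sum_congr rfl fun i _ => (mfderiv (𝓡 3) (𝓡 3) φ.symm x).map_smul _ _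
  have h3 : (WithLp.toLp 2 w : E3) = 0 :=
    hinj (this.trans (map_zero (mfderiv (𝓡 3) (𝓡 3) φ.symm x)).symm)
  exact hw (by simpa using congrArg WithLp.ofLp h3)

theorem sum_christoffel_mul_metricComp (g : SmoothMetric M)
    (hφ : φ ∈ IsManifold.maximalAtlas (𝓡 3) ∞ M) {x : E3} (hx : x ∈ φ.target) (i j l : Fin 3) :
    ∑ k, christoffel g φ i j k x * metricComp g φ k l x
      = lowerGamma (metricComp g φ) i j l x := by
  set A : Matrix (Fin 3) (Fin 3) ℝ := Matrix.of fun a b => metricComp g φ a b x with hA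
  have h : Matrix.vecMul (Matrix.vecMul (fun l => christoffelFirst g φ i j l x) A⁻¹) A
      = fun l => christoffelFirst g φ i j l x := by
    rw [Matrix.vecMul_vecMul, Matrix.nonsing_inv_mul _ (isUnit_det_metricComp g hφ hx),
      Matrix.vecMul_one]
  exact congrFun h l

/-- Contracting with the metric removes the inverse matrix, so that it never has to be
differentiated. -/
theorem lowerGeodesicEq_of_isGeodesicOn (hφ : φ ∈ IsManifold.maximalAtlas (𝓡 3) ∞ M)
    {c : ℝ → M} {J : Set ℝ} (hc : IsGeodesicOn g c J) {t : ℝ} (ht : t ∈ J)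
    (hts : c t ∈ φ.source) : LowerGeodesicEq (metricComp g φ) (fun s => φ (c s)) t := by
  intro l
  have h := fun k => congrArg (fun z => metricComp g φ k l (φ (c t)) * z)
    ((hc t ht).2 φ hφ hts k)
  have hsum : ∑ k, metricComp g φ k l (φ (c t)) * (iteratedDeriv 2 (fun s => φ (c s) k) t
        + ∑ i, ∑ j, christoffel g φ i j k (φ (c t))
            * deriv (fun s => φ (c s) i) t * deriv (fun s => φ (c s) j) t) = 0 := by
    simp only [mul_zero] at h
    simp only [h, Finset.sum_const_zero]
  rw [← hsum]
  simp only [iteratedDeriv_one, ← sum_christoffel_mul_metricComp g hφ (φ.map_source hts)]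
  simp only [Fin.sum_univ_three]
  ring

/-- Vectors over base points that are only provably equal are compared in the tangent bundle; this
carries orthonormality of the frame to the coordinate vectors. -/
theorem inner_eq_of_bundle_eq {p q : M} {v w : TangentSpace (𝓡 3) p} {v' w' : TangentSpace (𝓡 3) q}
    (hv : (⟨p, v⟩ : TangentBundle (𝓡 3) M) = ⟨q, v'⟩)
    (hw : (⟨p, w⟩ : TangentBundle (𝓡 3) M) = ⟨q, w'⟩) : g.inner p v w = g.inner q v' w' := by
  cases hv
  cases hw
  rfl

end Coordinates

/-! ### Verification that a Fermi chart yields a Fermi metric. -/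

theorem iteratedDeriv_of_eventuallyEq_affine {f : ℝ → ℝ} {t α β : ℝ}
    (hf : f =ᶠ[𝓝 t] fun r => α + r * β) :
    iteratedDeriv 1 f t = β ∧ iteratedDeriv 2 f t = 0 := by
  have hd : deriv (fun r : ℝ => α + r * β) = fun _ => β := by
    ext r
    simp
  refine ⟨?_, ?_⟩
  · rw [hf.iteratedDeriv_eq, iteratedDeriv_one, hd]
  · rw [hf.iteratedDeriv_eq, iteratedDeriv_succ, iteratedDeriv_one, hd]
    simp

theorem continuous_ray (s a b : ℝ) : Continuous fun t : ℝ => (!₂[s, t * a, t * b] : E3) := by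
  fun_prop

theorem eventually_ray_mem {M : Type*} [TopologicalSpace M]
    {φ : OpenPartialHomeomorph M E3} {s a b t : ℝ}
    (ht : (!₂[s, t * a, t * b] : E3) ∈ φ.target) :
    ∀ᶠ r in 𝓝 t, (!₂[s, r * a, r * b] : E3) ∈ φ.target :=
  (continuous_ray s a b).continuousAt.eventually (φ.open_target.mem_nhds ht)

theorem ray_coord {M : Type*} [TopologicalSpace M]
    {φ : OpenPartialHomeomorph M E3} {s a b t : ℝ}
    (ht : (!₂[s, t * a, t * b] : E3) ∈ φ.target) (m : Fin 3) :
    (fun r => φ (φ.symm !₂[s, r * a, r * b]) m)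
      =ᶠ[𝓝 t] fun r => ![s, 0, 0] m + r * ![0, a, b] m := by
  filter_upwards [eventually_ray_mem ht] with r hr
  rw [φ.right_inv hr]
  fin_cases m <;> simp

section Charts

variable {M : Type*} [TopologicalSpace M] [ChartedSpace E3 M] {φ : OpenPartialHomeomorph M E3}

theorem bundle_eq_of_components_eq (hφ : φ ∈ IsManifold.maximalAtlas (𝓡 3) ∞ M) {p q : M}
    {v : TangentSpace (𝓡 3) p} {w : TangentSpace (𝓡 3) q} (hpq : p = q) (hp : p ∈ φ.source)
    (hvw : components φ p v = components φ q w) : (⟨p, v⟩ : TangentBundle (𝓡 3) M) = ⟨q, w⟩ := by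
  subst hpq
  rw [(mdifferentiable_of_mem_maximalAtlas hφ).mfderiv_injective hp hvw]

end Charts

namespace IsFermiChart

variable {M : Type*} [TopologicalSpace M] [ChartedSpace E3 M] [IsManifold (𝓡 3) ∞ M]
  {g : SmoothMetric M} {γ₀ : ℝ → M} {I : Set ℝ}
  {E : Fin 3 → ∀ s, TangentSpace (𝓡 3) (γ₀ s)} {φ : OpenPartialHomeomorph M E3}

theorem axis_mem (h : IsFermiChart g γ₀ I E φ) {s : ℝ} (hs : s ∈ I) :
    (!₂[s, 0, 0] : E3) ∈ φ.target :=
  (h.axis s).2 hs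

theorem eq_symm_axis (h : IsFermiChart g γ₀ I E φ) {s : ℝ} (hs : s ∈ I) :
    γ₀ s = φ.symm !₂[s, 0, 0] := by
  have := congrArg Bundle.TotalSpace.proj (h.radial_velocity s hs 0 0)
  simpa [velocity] using this.symm

theorem mem_source (h : IsFermiChart g γ₀ I E φ) {s : ℝ} (hs : s ∈ I) : γ₀ s ∈ φ.source := by
  rw [h.eq_symm_axis hs]
  exact φ.map_target (h.axis_mem hs)

theorem chart_axis (h : IsFermiChart g γ₀ I E φ) {s : ℝ} (hs : s ∈ I) : φ (γ₀ s) = !₂[s, 0, 0] := by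
  rw [h.eq_symm_axis hs, φ.right_inv (h.axis_mem hs)]

theorem axis_coord (h : IsFermiChart g γ₀ I E φ) {s : ℝ} (hs : s ∈ I) (m : Fin 3) :
    (fun r => φ (γ₀ r) m) =ᶠ[𝓝 s] fun r => 0 + r * ![1, 0, 0] m := by
  filter_upwards [h.isOpen.mem_nhds hs] with r hr
  rw [h.chart_axis hr]
  fin_cases m <;> simp

/-- The ray with this initial velocity is affine in the chart, with slope `(0, a, b)`. -/
theorem components_frame (h : IsFermiChart g γ₀ I E φ) {s : ℝ} (hs : s ∈ I) (a b : ℝ) :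
    components φ (γ₀ s) (a • E 1 s + b • E 2 s) = !₂[0, a, b] := by
  have hmem : (!₂[s, 0 * a, 0 * b] : E3) ∈ φ.target := by simpa using h.axis_mem hs
  have hmd : MDifferentiableAt 𝓘(ℝ, ℝ) (𝓡 3) (fun t : ℝ => φ.symm !₂[s, t * a, t * b]) 0 :=
    ((h.radial_geodesic s hs a b 0 hmem).1).mdifferentiableAt (by simp)
  have hv : bundleComponents φ (velocity (fun t : ℝ => φ.symm !₂[s, t * a, t * b]) 0)
      = components φ (γ₀ s) (a • E 1 s + b • E 2 s) := by
    rw [h.radial_velocity s hs a b]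
    rfl
  rw [← hv]
  ext m
  have h1 := (hasDerivAt_chart_comp_apply h.mem_atlas hmd (φ.map_target hmem) m).deriv
  rw [← h1, ← iteratedDeriv_one,
    (iteratedDeriv_of_eventuallyEq_affine (ray_coord hmem m)).1]

theorem lowerGamma_radial (h : IsFermiChart g γ₀ I E φ) {s : ℝ} (hs : s ∈ I) {a b t : ℝ}
    (ht : (!₂[s, t * a, t * b] : E3) ∈ φ.target) (l : Fin 3) :
    ∑ i, ∑ j, lowerGamma (metricComp g φ) i j l !₂[s, t * a, t * b]
      * ![0, a, b] i * ![0, a, b] j = 0 := by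
  have := lowerGeodesicEq_of_isGeodesicOn h.mem_atlas (h.radial_geodesic s hs a b) ht
    (φ.map_target ht) l
  simpa only [(iteratedDeriv_of_eventuallyEq_affine (ray_coord ht _)).1,
    (iteratedDeriv_of_eventuallyEq_affine (ray_coord ht _)).2, φ.right_inv ht, mul_zero,
    Finset.sum_const_zero, zero_add] using this

theorem lowerGamma_zero_zero (h : IsFermiChart g γ₀ I E φ) {s : ℝ} (hs : s ∈ I) (l : Fin 3) :
    lowerGamma (metricComp g φ) 0 0 l !₂[s, 0, 0] = 0 := by
  have := lowerGeodesicEq_of_isGeodesicOn h.mem_atlas h.geodesic hs (h.mem_source hs) l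
  simp only [(iteratedDeriv_of_eventuallyEq_affine (h.axis_coord hs _)).1,
    (iteratedDeriv_of_eventuallyEq_affine (h.axis_coord hs _)).2, h.chart_axis hs] at this
  simpa [Fin.sum_univ_three] using this

theorem components_frame_one (h : IsFermiChart g γ₀ I E φ) {s : ℝ} (hs : s ∈ I) :
    components φ (γ₀ s) (E 1 s) = !₂[0, 1, 0] := by
  simpa using h.components_frame hs 1 0

theorem components_frame_two (h : IsFermiChart g γ₀ I E φ) {s : ℝ} (hs : s ∈ I) :
    components φ (γ₀ s) (E 2 s) = !₂[0, 0, 1] := by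
  simpa using h.components_frame hs 0 1

/-- A parallel field with constant components reduces the transport equation along the axis to
`Γ_{0n}^k = 0`. -/
theorem lowerGamma_zero_of_components (h : IsFermiChart g γ₀ I E φ) {s : ℝ} (hs : s ∈ I)
    {n : Fin 3} (hn : ∀ r ∈ I, ∀ k, components φ (γ₀ r) (E n r) k = if k = n then 1 else 0)
    (l : Fin 3) : lowerGamma (metricComp g φ) 0 n l !₂[s, 0, 0] = 0 := by
  have hΓ : ∀ k, christoffel g φ 0 n k !₂[s, 0, 0] = 0 := by
    intro k
    have h1 := h.parallel n s hs φ h.mem_atlas (h.mem_source hs) k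
    have h2 : (fun r => components φ (γ₀ r) (E n r) k) =ᶠ[𝓝 s] fun _ => if k = n then 1 else 0 := by
      filter_upwards [h.isOpen.mem_nhds hs] with r hr using hn r hr k
    have h3 := h1.unique ((hasDerivAt_const s _).congr_of_eventuallyEq h2)
    simp only [← iteratedDeriv_one, (iteratedDeriv_of_eventuallyEq_affine (h.axis_coord hs _)).1,
      hn s hs, h.chart_axis hs] at h3
    simpa [Fin.sum_univ_three] using h3
  rw [← sum_christoffel_mul_metricComp g h.mem_atlas (h.axis_mem hs)]
  simp [hΓ]

theorem lowerGamma_symm (i j l : Fin 3) (x : E3) :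
    lowerGamma (metricComp g φ) i j l x = lowerGamma (metricComp g φ) j i l x := by
  simp only [lowerGamma, metricComp_symm g φ j i]
  ring

theorem lowerGamma_axis (h : IsFermiChart g γ₀ I E φ) {s : ℝ} (hs : s ∈ I) (i j l : Fin 3) :
    lowerGamma (metricComp g φ) i j l !₂[s, 0, 0] = 0 := by
  have h00 := h.lowerGamma_zero_zero hs l
  have h01 := h.lowerGamma_zero_of_components hs (n := 1) (fun r hr k => by
    rw [h.components_frame_one hr]; fin_cases k <;> simp) l
  have h02 := h.lowerGamma_zero_of_components hs (n := 2) (fun r hr k => by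
    rw [h.components_frame_two hr]; fin_cases k <;> simp) l
  -- At `t = 0` the radial equation is a quadratic form in `(a, b)`; three directions and symmetry
  -- recover its coefficients by polarisation.
  have hrad : ∀ a b : ℝ, _ := fun a b =>
    h.lowerGamma_radial hs (a := a) (b := b) (t := 0) (by simpa using h.axis_mem hs) l
  have h11 := hrad 1 0
  have h22 := hrad 0 1
  have h12 := hrad 1 1
  simp [Fin.sum_univ_three] at h11 h22 h12
  have hs21 := lowerGamma_symm (g := g) (φ := φ) 2 1 l !₂[s, 0, 0]
  have h12' : lowerGamma (metricComp g φ) 1 2 l !₂[s, 0, 0] = 0 := by linarith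
  have h10 := (lowerGamma_symm (g := g) (φ := φ) 1 0 l !₂[s, 0, 0]).trans h01
  have h20 := (lowerGamma_symm (g := g) (φ := φ) 2 0 l !₂[s, 0, 0]).trans h02
  fin_cases i <;> fin_cases j <;> simp only [Fin.zero_eta, Fin.mk_one, Fin.reduceFinMk] <;>
    linarith

/-- Both sides have the same components: for index 0 by the velocity of `γ₀`, for 1 and 2 by the
radial velocities. -/
theorem coordVec_eq_frame (h : IsFermiChart g γ₀ I E φ) (i : Fin 3) :
    (⟨φ.symm !₂[0, 0, 0], coordVec φ i !₂[0, 0, 0]⟩ : TangentBundle (𝓡 3) M)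
      = ⟨γ₀ 0, E i 0⟩ := by
  have h0 := h.zero_mem
  refine bundle_eq_of_components_eq h.mem_atlas (h.eq_symm_axis h0).symm
    (φ.map_target (h.axis_mem h0)) ?_
  have hL : components φ (φ.symm !₂[0, 0, 0]) (coordVec φ i !₂[0, 0, 0])
      = EuclideanSpace.single i 1 := bundleComponents_mfderiv_symm h.mem_atlas (h.axis_mem h0) _
  rw [hL]
  fin_cases i
  · have hv : bundleComponents φ (velocity γ₀ 0) = components φ (γ₀ 0) (E 0 0) := by
      rw [h.velocity_zero]
      rfl
    refine Eq.trans ?_ hv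
    ext m
    have hmd : MDifferentiableAt 𝓘(ℝ, ℝ) (𝓡 3) γ₀ 0 := (h.geodesic 0 h0).1.mdifferentiableAt
      (by simp)
    have h1 := (hasDerivAt_chart_comp_apply h.mem_atlas hmd (h.mem_source h0) m).deriv
    rw [← h1, ← iteratedDeriv_one,
      (iteratedDeriv_of_eventuallyEq_affine (h.axis_coord h0 m)).1]
    fin_cases m <;> simp
  · refine Eq.trans ?_ (h.components_frame_one h0).symm
    ext m
    fin_cases m <;> simp
  · refine Eq.trans ?_ (h.components_frame_two h0).symm
    ext m
    fin_cases m <;> simp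

theorem isFermiMetric (h : IsFermiChart g γ₀ I E φ) :
    IsFermiMetric (metricComp g φ) φ.target I where
  isOpen_domain := φ.open_target
  isOpen_axis := h.isOpen
  ordConnected := h.ordConnected
  zero_mem := h.zero_mem
  axis_mem _ hs := h.axis_mem hs
  contDiffOn := contDiffOn_metricComp g h.mem_atlas
  symm := metricComp_symm g φ
  base i j := by
    rw [← h.orthonormal i j]
    exact inner_eq_of_bundle_eq (h.coordVec_eq_frame i) (h.coordVec_eq_frame j)
  lowerGamma_axis _ hs := h.lowerGamma_axis hs
  radial s hs a b l := by
    have hmem : (!₂[s, 0 * a, 0 * b] : E3) ∈ φ.target := by simpa using h.axis_mem hs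
    filter_upwards [eventually_ray_mem hmem] with t ht using h.lowerGamma_radial hs ht l

/-- The coordinate expression of a geodesic that starts on the axis. -/
theorem geodesic_coord (h : IsFermiChart g γ₀ I E φ) {x₁ θ : ℝ} (hx : x₁ ∈ I) {γ : ℝ → M}
    (hγ : IsGeodesicFrom g φ x₁ θ γ) :
    ContDiffAt ℝ ∞ (fun t => φ (γ t)) 0 ∧ φ (γ 0) = !₂[x₁, 0, 0] ∧
      (∀ m, iteratedDeriv 1 (fun t => φ (γ t) m) 0 = ![Real.cos θ, Real.sin θ, 0] m) ∧
      ∀ᶠ t in 𝓝 0, LowerGeodesicEq (metricComp g φ) (fun s => φ (γ s)) t := by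
  obtain ⟨⟨ε, hε, hgeo⟩, h0, hv⟩ := hγ
  have h0mem : (0 : ℝ) ∈ Set.Ioo (-ε) ε := by simp [hε]
  have hsm := (hgeo 0 h0mem).1
  have hsrc : γ 0 ∈ φ.source := by
    rw [h0]
    exact φ.map_target (h.axis_mem hx)
  refine ⟨?_, ?_, fun m => ?_, ?_⟩
  · rw [← contMDiffAt_iff_contDiffAt]
    exact (((contMDiffOn_of_mem_maximalAtlas h.mem_atlas).contMDiffAt
      (φ.open_source.mem_nhds hsrc)).comp 0 hsm)
  · rw [h0, φ.right_inv (h.axis_mem hx)]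
  · rw [iteratedDeriv_one, (hasDerivAt_chart_comp_apply h.mem_atlas
      (hsm.mdifferentiableAt (by simp)) hsrc m).deriv, hv]
    have hlin : (Real.cos θ • coordVec φ 0 !₂[x₁, 0, 0] + Real.sin θ • coordVec φ 1 !₂[x₁, 0, 0] :
        TangentSpace (𝓡 3) (φ.symm !₂[x₁, 0, 0]))
        = mfderiv (𝓡 3) (𝓡 3) φ.symm !₂[x₁, 0, 0]
          (Real.cos θ • EuclideanSpace.single 0 1 + Real.sin θ • EuclideanSpace.single 1 1 : E3) :=
      by
        refine Eq.symm (((mfderiv (𝓡 3) (𝓡 3) φ.symm !₂[x₁, 0, 0]).map_add _ _).trans ?_)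
        congr 1
        · exact (mfderiv (𝓡 3) (𝓡 3) φ.symm !₂[x₁, 0, 0]).map_smul _ _
        · exact (mfderiv (𝓡 3) (𝓡 3) φ.symm !₂[x₁, 0, 0]).map_smul _ _
    rw [hlin, bundleComponents_mfderiv_symm h.mem_atlas (h.axis_mem hx)]
    fin_cases m <;> simp
  · filter_upwards [Ioo_mem_nhds h0mem.1 h0mem.2,
      hsm.continuousAt.eventually (φ.open_source.mem_nhds hsrc)] with t ht hts
    exact lowerGeodesicEq_of_isGeodesicOn h.mem_atlas hgeo ht hts

end IsFermiChart

end

theorem proposition3p2 {M : Type*} [TopologicalSpace M] [ChartedSpace E3 M]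
    [IsManifold (𝓡 3) ∞ M] (g : SmoothMetric M) (γ₀ : ℝ → M) (I : Set ℝ)
    (E : Fin 3 → ∀ s, TangentSpace (𝓡 3) (γ₀ s)) (φ : OpenPartialHomeomorph M E3)
    (hφ : IsFermiChart g γ₀ I E φ) :
    (∀ x₁ ∈ I, ∀ θ ∈ Set.Ico (-Real.pi) Real.pi, ∀ γ : ℝ → M, IsGeodesicFrom g φ x₁ θ γ →
      (∀ k : Fin 3, iteratedDeriv 2 (fun t => φ (γ t) k) 0 = 0) ∧
      iteratedDeriv 3 (fun t => φ (γ t) 2) 0 =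
        1 / 2 * Real.cos θ ^ 2 * Real.sin θ *
            partialD 1 (partialD 2 (metricComp g φ 0 0)) !₂[x₁, 0, 0]
          + 3 * Real.cos θ * Real.sin θ ^ 2 *
            partialD 1 (partialD 2 (metricComp g φ 0 1)) !₂[x₁, 0, 0]) ∧
    (∀ K ⊆ I, IsCompact K → ∃ C : ℝ, ∀ x₁ ∈ K, ∀ θ ∈ Set.Ico (-Real.pi) Real.pi,
      ∀ γ : ℝ → M, IsGeodesicFrom g φ x₁ θ γ →
      |iteratedDeriv 4 (fun t => φ (γ t) 2) 0 -
        Real.cos θ ^ 3 * Real.sin θ *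
          partialD 0 (partialD 1 (partialD 2 (metricComp g φ 0 0))) !₂[x₁, 0, 0]|
        ≤ C * θ ^ 2) := by
  have hG := hφ.isFermiMetric
  refine ⟨fun x₁ hx θ _ γ hγ => ?_, fun K hK hKc => ?_⟩
  · obtain ⟨hc, hc0, hv, hgeo⟩ := hφ.geodesic_coord hx hγ
    exact ⟨(hG.taylor_geodesic hx hc hc0 hv hgeo).1, hG.third_deriv_geodesic hx hc hc0 hv hgeo⟩
  · obtain ⟨C, hC0, hC⟩ := hG.fourth_deriv_geodesic hK hKc
    refine ⟨C, fun x₁ hx θ _ γ hγ => ?_⟩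
    obtain ⟨hc, hc0, hv, hgeo⟩ := hφ.geodesic_coord (hK hx) hγ
    refine (hC x₁ hx _ _ (Real.abs_cos_le_one θ) (Real.abs_sin_le_one θ) _ hc hc0 hv hgeo).trans ?_
    -- The bound `C sin² θ` becomes `C θ²`; this uses `0 ≤ C`.
    exact mul_le_mul_of_nonneg_left (sq_le_sq.2 Real.abs_sin_le_abs) hC0
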